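/- For $n\ge 1$ let $E_n=\{x_i=1,\ x_i+x_j=x_k,\ x_i\cdot x_j=x_k : i,j,k\in\{1,\dots,n\}\}$. For a function $\psi:\mathbb N\to\mathbb N$ let $C(\psi)$ be the statement: for every $n$, if a system $S\subseteq E_n$ has only finitely many solutions in integers $x_1,\dots,x_n$, then each such solution satisfies $|x_1|,\dots,|x_n|\le\psi(n)$. Conjecture 1 is $C(\psi)$ for $\psi(n)=2^{2^{n-1}}$. For a polynomial $D$ with integer coefficients in finitely many variables, let $M$ be the maximum of the absolute values of its coefficients and $d_i$ its degree in the $i$-th variable; put $\mathrm{bound}_\psi(D)=\psi\bigl((2M+1)^{\prod_i(d_i+1)}\bigr)$, so that for $\psi(n)=2^{2^{n-1}}$ one has $\mathrm{bound}_\psi(D)=\mathrm{bound}(D)=2^{2^{(2M+1)^{\prod_i (d_i+1)}-1}}$. For $D\in\mathbb Z[x_1,\dots,x_p]$ put $$\widehat D=D(x_1,\dots,x_p)^2+\sum_{i=1}^p\bigl(x_i-a_i^2-b_i^2-c_i^2-d_i^2\bigr)^2\in\mathbb Z[x_1,a_1,b_1,c_1,d_1,\dots,x_p,a_p,b_p,c_p,d_p].$$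 Diophantine equations $D(x_1,\dots,x_p)=0$ are presented to algorithms by the number $p$ and a list of the terms of $D$ (coefficient and exponents). **Theorem.** Conjecture 1 implies that the set of Diophantine equations which have infinitely many solutions in integers is recursively enumerable, and that the set of Diophantine equations which have infinitely many solutions in non-negative integers is recursively enumerable. More precisely, let $\psi$ be any computable function; $\psi(n)=2^{2^{n-1}}$ is one. Consider the following two procedures with input $D$. (a) Start with $\alpha=\mathrm{bound}_\psi(D)+1$ and, while no integer solution $(y_1,\dots,y_p)$ of $D=0$ has $\max(|y_1|,\dots,|y_p|)=\alpha$, increase $\alpha$ by $1$. (b) Start with $\theta=\mathrm{bound}_\psi(\widehat D)+1$ and, while no non-negative integer solution $(y_1,\dots,y_p)$ of $D=0$ has $\max(y_1,\dots,y_p)=\theta$, increase $\theta$ by $1$. Both procedures, returning the final value of $\alpha$ (respectively $\theta$), are partial recursive functions of the presentation of $D$. If $C(\psi)$ holds, then (a) terminates on $D$ if and only if $D=0$ has infinitely many integer solutions, (b) terminates on $D$ if and only if $D=0$ has infinitely many non-negative integer solutions, and hence both of the above sets of equations are recursively enumerable. -/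

import Mathlib

namespace Dio

/-- The equations `x_i = 1`, `x_i + x_j = x_k`, `x_i * x_j = x_k` that make up `E_n`. -/
inductive Eqn (n : ℕ) : Type
  | one (i : Fin n) : Eqn n
  | add (i j k : Fin n) : Eqn n
  | mul (i j k : Fin n) : Eqn n

/-- The integer tuple `x` satisfies the given equation of `E_n`. -/
def Eqn.Holds {n : ℕ} (x : Fin n → ℤ) : Eqn n → Prop
  | .one i => x i = 1
  | .add i j k => x i + x j = x k
  | .mul i j k => x i * x j = x k

/-- The integer solutions of a system `S ⊆ E_n`. -/
def systemSolutions {n : ℕ} (S : Set (Eqn n)) : Set (Fin n → ℤ) :=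
  {x | ∀ e ∈ S, e.Holds x}

/-- If a system `S ⊆ E_n` has only finitely many integer solutions, then every coordinate of every
solution is at most `ψ n` in absolute value. -/
def BoundConjecture (ψ : ℕ → ℕ) : Prop :=
  ∀ (n : ℕ) (S : Set (Eqn n)), (systemSolutions S).Finite →
    ∀ x ∈ systemSolutions S, ∀ i, |x i| ≤ (ψ n : ℤ)

/-- The function `n ↦ 2 ^ (2 ^ (n - 1))`. -/
def doubleExp (n : ℕ) : ℕ := 2 ^ 2 ^ (n - 1)

/-- The conjecture with the bound `2 ^ (2 ^ (n - 1))`. -/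
def Conjecture1 : Prop := BoundConjecture doubleExp

/-- The maximum of the absolute values of the coefficients (`0` for the zero polynomial). -/
noncomputable def coeffMax {σ : Type} (D : MvPolynomial σ ℤ) : ℕ :=
  D.support.sup fun m => (D.coeff m).natAbs

/-- The number `(2M+1) ^ ((d_1+1) ⋯ (d_p+1))`, with `M` the maximum of the absolute values of the
coefficients of `D` and `d_i` the degree of `D` in the `i`-th variable. -/
noncomputable def size {σ : Type} [Fintype σ] (D : MvPolynomial σ ℤ) : ℕ :=
  (2 * coeffMax D + 1) ^ ∏ i, (D.degreeOf i + 1)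

/-- The bound on solutions computed from `D` and `ψ`; for `ψ = doubleExp` this is
`2 ^ (2 ^ ((2M+1) ^ ((d_1+1) ⋯ (d_p+1)) - 1))`. -/
noncomputable def bound (ψ : ℕ → ℕ) {σ : Type} [Fintype σ] (D : MvPolynomial σ ℤ) : ℕ :=
  ψ (size D)

/-- `D(x)^2 + ∑ i, (x_i - a_i^2 - b_i^2 - c_i^2 - d_i^2)^2`, where the variables
`x_i, a_i, b_i, c_i, d_i` are indexed by `(i, 0), …, (i, 4)`. -/
noncomputable def hat {p : ℕ} (D : MvPolynomial (Fin p) ℤ) : MvPolynomial (Fin p × Fin 5) ℤ :=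
  (MvPolynomial.rename (fun i => (i, (0 : Fin 5))) D) ^ 2 +
    ∑ i : Fin p, (MvPolynomial.X (i, 0) - MvPolynomial.X (i, 1) ^ 2 - MvPolynomial.X (i, 2) ^ 2
      - MvPolynomial.X (i, 3) ^ 2 - MvPolynomial.X (i, 4) ^ 2) ^ 2

/-- The solutions of `D = 0` in integers. -/
def intSolutions {p : ℕ} (D : MvPolynomial (Fin p) ℤ) : Set (Fin p → ℤ) :=
  {y | MvPolynomial.eval y D = 0}

/-- The solutions of `D = 0` in non-negative integers. -/
def natSolutions {p : ℕ} (D : MvPolynomial (Fin p) ℤ) : Set (Fin p → ℕ) :=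
  {y | MvPolynomial.eval (fun i => (y i : ℤ)) D = 0}

/-- A Diophantine equation `D(x_1, …, x_p) = 0`: the number `p` of variables and the polynomial. -/
abbrev Equation : Type := Σ p : ℕ, MvPolynomial (Fin p) ℤ

/-- A finite description of a Diophantine equation: the number of variables, and a list of terms,
each given by its coefficient and its list of exponents. -/
abbrev Code : Type := ℕ × List (ℤ × List ℕ)

/-- The polynomial described by a code: the sum of the listed terms. Missing exponents are `0`,
superfluous ones are ignored, and repeated monomials are added up. -/
noncomputable def Code.poly (c : Code) : MvPolynomial (Fin c.1) ℤ :=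
  (c.2.map fun t => MvPolynomial.monomial
    (Finsupp.equivFunOnFinite.symm fun i : Fin c.1 => t.2.getD i 0) t.1).sum

/-- The equation described by a code. -/
noncomputable def Code.equation (c : Code) : Equation := ⟨c.1, c.poly⟩

/-- Every Diophantine equation has a code. -/
theorem Code.equation_surjective : Function.Surjective Code.equation := by
  rintro ⟨p, D⟩
  refine ⟨(p, D.support.toList.map fun m => (D.coeff m, List.ofFn m)), ?_⟩
  have h : Code.poly (p, D.support.toList.map fun m => (D.coeff m, List.ofFn m)) = D := by
    conv_rhs => rw [D.as_sum, ← Finset.sum_map_toList]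
    simp only [Code.poly, List.map_map]
    congr 1
    refine List.map_congr_left fun m _ => ?_
    simp only [Function.comp]
    congr 1
    ext i
    simp [List.getD]
  exact congrArg (Sigma.mk p) h

/-- A set of Diophantine equations is recursively enumerable: its set of codes is. -/
def IsRE (S : Set Equation) : Prop := REPred fun c : Code => c.equation ∈ S

/-- The equations with infinitely many solutions in integers. -/
def infiniteInt : Set Equation := {E | (intSolutions E.2).Infinite}

/-- The equations with infinitely many solutions in non-negative integers. -/
def infiniteNat : Set Equation := {E | (natSolutions E.2).Infinite}

open Classical in
/-- The loop that starts with `α = B + 1` and, while no integer solution `y` of `D = 0` has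
`max |y_i| = α`, increases `α` by `1`. It returns the final `α` if it terminates. -/
noncomputable def searchInt (B : ℕ) {p : ℕ} (D : MvPolynomial (Fin p) ℤ) : Part ℕ :=
  (Nat.rfind fun k => Part.some
    (decide (∃ y ∈ intSolutions D, (Finset.univ.sup fun i => (y i).natAbs) = B + 1 + k))).map
      fun k => B + 1 + k

open Classical in
/-- The loop that starts with `θ = B + 1` and, while no non-negative integer solution `y` of
`D = 0` has `max y_i = θ`, increases `θ` by `1`. It returns the final `θ` if it terminates. -/
noncomputable def searchNat (B : ℕ) {p : ℕ} (D : MvPolynomial (Fin p) ℤ) : Part ℕ :=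
  (Nat.rfind fun k => Part.some
    (decide (∃ y ∈ natSolutions D, Finset.univ.sup y = B + 1 + k))).map
      fun k => B + 1 + k

/-- The semi-algorithm for integer solutions, run on a code. -/
noncomputable def semiInt (ψ : ℕ → ℕ) (c : Code) : Part ℕ :=
  searchInt (bound ψ c.poly) c.poly

/-- The semi-algorithm for non-negative integer solutions, run on a code. -/
noncomputable def semiNat (ψ : ℕ → ℕ) (c : Code) : Part ℕ :=
  searchNat (bound ψ (hat c.poly)) c.poly

end Dio

/-! Let `M` be the largest absolute value of a coefficient of `D` and `d i` its degrees. Exactly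
`size D = (2M+1) ^ ∏ (d i + 1)` polynomials have coefficients in `[-M, M]` and degree at most `d i`
in each variable. Give each of them an unknown, and impose every identity `P = 1`, `P + Q = R`, `P *
Q = R` that holds among them. If the variables themselves are in this box, every member is reached
from `1` and the variables without leaving the box, so a solution of the system is evaluation at an
integer point (`eq_eval_of_respects`). One more equation, `D + D = D`, makes that point a zero of
`D`. The system is thus a copy of `D = 0` in `size D` unknowns, and the conjecture bounds the zeros
of `D` whenever they are finitely many (`abs_le_bound`).

Hence a zero beyond the bound certifies infinitely many zeros; conversely an infinite set of integer
points has members of arbitrarily large maximum norm, so the search succeeds. For non-negative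
solutions, Lagrange's four-square theorem transfers the problem to `hat D`, which has finitely many
integer zeros as soon as `D` has finitely many non-negative ones.

On codes, the size of the polynomial, a code of `hat D` and the test for a zero of given maximum
norm are all primitive recursive. Only `ψ` and the final unbounded search go beyond that. -/

namespace Dio

/-! ### The box of polynomials and the bound on zeros. -/

section Bounds

open MvPolynomial

/-- The coefficients of `W` are at most `M` in absolute value, and only monomials that divide
`∏ i, x_i ^ d i` occur in `W`. -/
def InBox {σ : Type} (M : ℕ) (d : σ → ℕ) (W : MvPolynomial σ ℤ) : Prop :=
  ∀ m, |W.coeff m| ≤ (M : ℤ) ∧ (W.coeff m ≠ 0 → ∀ i, m i ≤ d i)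

theorem inBox_self {σ : Type} (D : MvPolynomial σ ℤ) :
    InBox (coeffMax D) (fun i => D.degreeOf i) D := by
  intro m
  refine ⟨?_, fun h i => degreeOf_le_iff.1 le_rfl m (mem_support_iff.2 h)⟩
  by_cases h : D.coeff m = 0
  · simp [h]
  · rw [Int.abs_eq_natAbs]
    exact_mod_cast Finset.le_sup (f := fun m => (D.coeff m).natAbs) (mem_support_iff.2 h)

theorem inBox_monomial {σ : Type} {M : ℕ} {d : σ → ℕ} {m : σ →₀ ℕ} {c : ℤ}
    (hm : ∀ i, m i ≤ d i) (hc : |c| ≤ (M : ℤ)) : InBox M d (monomial m c) := by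
  classical
  intro m'
  rw [coeff_monomial]
  split_ifs with h
  · subst h
    exact ⟨hc, fun _ => hm⟩
  · simp

/-- Partial sums of the terms of `W` stay in the box, which allows `W` to be assembled term by term.
-/
theorem InBox.restrict {σ : Type} {M : ℕ} {d : σ → ℕ} {W : MvPolynomial σ ℤ} (h : InBox M d W)
    (s : Finset (σ →₀ ℕ)) : InBox M d (∑ m ∈ s, monomial m (W.coeff m)) := by
  classical
  intro m
  have : (∑ m ∈ s, monomial m (W.coeff m)).coeff m = if m ∈ s then W.coeff m else 0 := by
    simp [coeff_sum, coeff_monomial]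
  rw [this]
  split_ifs
  · exact h m
  · simp

/-- The polynomial with the given table of coefficients, shifted by `M`. -/
noncomputable def tablePoly {σ : Type} [Fintype σ] (M : ℕ) (d : σ → ℕ)
    (t : (∀ i, Fin (d i + 1)) → Fin (2 * M + 1)) : MvPolynomial σ ℤ :=
  open Classical in
  ∑ m : ∀ i, Fin (d i + 1),
    monomial (Finsupp.equivFunOnFinite.symm fun i => (m i : ℕ)) ((t m : ℤ) - M)

theorem inBox_tablePoly {σ : Type} [Fintype σ] (M : ℕ) (d : σ → ℕ)
    (t : (∀ i, Fin (d i + 1)) → Fin (2 * M + 1)) : InBox M d (tablePoly M d t) := by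
  classical
  intro m
  unfold tablePoly
  simp only [coeff_sum, coeff_monomial]
  by_cases hm : ∀ i, m i ≤ d i
  · refine ⟨?_, fun _ => hm⟩
    rw [Finset.sum_eq_single fun i => ⟨m i, Nat.lt_succ_of_le (hm i)⟩]
    · have : (t fun i => ⟨m i, Nat.lt_succ_of_le (hm i)⟩ : ℕ) < 2 * M + 1 := Fin.is_lt _
      split_ifs
      · rw [abs_le]; omega
      · simp
    · intro b _ hb
      refine if_neg fun h => hb ?_
      funext i
      ext
      simp [← h]
    · simp
  · rw [Finset.sum_eq_zero fun b _ => if_neg ?_]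
    · simp
    · rintro rfl
      exact hm fun i => by simpa using Nat.le_of_lt_succ (b i).is_lt

theorem exists_tablePoly_eq {σ : Type} [Fintype σ] {M : ℕ} {d : σ → ℕ} {W : MvPolynomial σ ℤ}
    (h : InBox M d W) : ∃ t, tablePoly M d t = W := by
  classical
  let e : (∀ i, Fin (d i + 1)) → σ →₀ ℕ := fun m => Finsupp.equivFunOnFinite.symm fun i => (m i : ℕ)
  have he : Function.Injective e := fun a b hab => by
    funext i
    have := DFunLike.congr_fun hab i
    simpa [e, Fin.ext_iff] using this
  have hb : ∀ m, (W.coeff m + M).toNat < 2 * M + 1 := fun m => by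
    have := abs_le.1 (h m).1
    omega
  refine ⟨fun m => ⟨(W.coeff (e m) + M).toNat, hb _⟩, ?_⟩
  have hval : ∀ m, (((W.coeff m + M).toNat : ℕ) : ℤ) - M = W.coeff m := fun m => by
    have := abs_le.1 (h m).1
    omega
  unfold tablePoly
  simp only [hval]
  ext m
  rw [coeff_sum]
  simp only [coeff_monomial]
  by_cases hm : ∃ a, e a = m
  · obtain ⟨a, rfl⟩ := hm
    rw [Finset.sum_eq_single a]
    · simp [e]
    · intro b _ hba
      exact if_neg fun hh => hba (he hh)
    · simp
  · rw [Finset.sum_eq_zero]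
    · by_contra hne
      have hd := (h m).2 (Ne.symm hne)
      exact hm ⟨fun i => ⟨m i, Nat.lt_succ_of_le (hd i)⟩, by ext i; simp [e]⟩
    · intro b _
      exact if_neg fun hh => hm ⟨b, hh⟩

/-- Let `P` list polynomials, among them all those in a box that contains `x_i` for all `i`. If `f`
respects the identities `P a = 1`, `P a + P b = P c` and `P a * P b = P c`, then on the box it is
evaluation at a point. -/
theorem eq_eval_of_respects {σ τ : Type} {M : ℕ} {d : σ → ℕ} (hM : 1 ≤ M)
    {P : τ → MvPolynomial σ ℤ} (hP : ∀ W, InBox M d W → ∃ t, P t = W)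
    {f : τ → ℤ} (h1 : ∀ a, P a = 1 → f a = 1)
    (hadd : ∀ a b c, P a + P b = P c → f a + f b = f c)
    (hmul : ∀ a b c, P a * P b = P c → f a * f b = f c)
    {x : σ → τ} (hx : ∀ i, P (x i) = X i) {t : τ} (ht : InBox M d (P t)) :
    f t = eval (fun i => f (x i)) (P t) := by
  classical
  set y : σ → ℤ := fun i => f (x i) with hy
  have hM' : |(1 : ℤ)| ≤ (M : ℤ) := by simpa using hM
  -- The identity `0 + 0 = 0` forces the value `0`.
  have good_zero : ∀ t, P t = 0 → f t = 0 := fun t ht => by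
    have := hadd t t t (by simp [ht])
    omega
  obtain ⟨z, hz⟩ := hP 0 fun m => by simp
  have ext_f : ∀ a b, P a = P b → f a = f b := fun a b hab => by
    have := hadd a z b (by simp [hz, hab])
    rw [← this, good_zero z hz, add_zero]
  -- monomials with coefficient one
  have good_mon : ∀ m : σ →₀ ℕ, (∀ i, m i ≤ d i) → ∀ t, P t = monomial m 1 →
      f t = eval y (monomial m 1) := by
    intro m
    induction m using WellFoundedLT.induction with
    | ind m ih =>
      intro hm t ht
      by_cases h0 : m = 0
      · subst h0
        rw [h1 t (by rw [ht]; rfl)]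
        simp
      · obtain ⟨i, hi⟩ := Finsupp.ne_iff.1 h0
        have hi : m i ≠ 0 := hi
        have hsub : Finsupp.single i 1 ≤ m := by
          rw [Finsupp.single_le_iff]; omega
        have hle : m - Finsupp.single i 1 ≤ m := tsub_le_self
        have heq : m - Finsupp.single i 1 + Finsupp.single i 1 = m := tsub_add_cancel_of_le hsub
        have hlt : m - Finsupp.single i 1 < m := by
          refine lt_of_le_of_ne hle fun hh => ?_
          have := DFunLike.congr_fun hh i
          simp at this
          omega
        have hm' : ∀ j, (m - Finsupp.single i 1 : σ →₀ ℕ) j ≤ d j := fun j => (hle j).trans (hm j)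
        obtain ⟨s, hs⟩ := hP _ (inBox_monomial hm' hM')
        have hprod : (monomial (m - Finsupp.single i 1) (1 : ℤ)) * X i = monomial m 1 := by
          rw [X, monomial_mul, heq, mul_one]
        rw [← hmul s (x i) t (by rw [hs, hx, ht, hprod]), ih _ hlt hm' s hs, ← hprod]
        simp [hy]
  have good_nat : ∀ m : σ →₀ ℕ, (∀ i, m i ≤ d i) → ∀ c : ℕ, c ≤ M → ∀ t,
      P t = monomial m (c : ℤ) → f t = eval y (monomial m (c : ℤ)) := by
    intro m hm c
    induction c with
    | zero => intro _ t ht; rw [good_zero t (by simpa using ht)]; simp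
    | succ c ih =>
      intro hc t ht
      obtain ⟨s, hs⟩ := hP (monomial m (c : ℤ))
        (inBox_monomial hm (by rw [Nat.abs_cast]; exact_mod_cast (by omega : c ≤ M)))
      obtain ⟨u, hu⟩ := hP (monomial m 1) (inBox_monomial hm hM')
      have hsum : monomial m (c : ℤ) + monomial m 1 = monomial m ((c + 1 : ℕ) : ℤ) := by
        rw [← map_add]; simp
      rw [← hadd s u t (by rw [hs, hu, ht, hsum]), ih (by omega) s hs, good_mon m hm u hu, ← hsum,
        map_add]
  have good_int : ∀ m : σ →₀ ℕ, (∀ i, m i ≤ d i) → ∀ c : ℤ, |c| ≤ (M : ℤ) → ∀ t,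
      P t = monomial m c → f t = eval y (monomial m c) := by
    intro m hm c hc t ht
    obtain ⟨k, rfl | rfl⟩ := Int.eq_nat_or_neg c
    · exact good_nat m hm k (by simpa using hc) t ht
    · have hk : k ≤ M := by simpa using hc
      obtain ⟨s, hs⟩ := hP (monomial m (k : ℤ)) (inBox_monomial hm (by simpa using hk))
      -- Negative coefficients come from `-k + k = 0`, where all three terms lie in the box.
      have h := hadd t s z (by rw [ht, hs, hz, ← map_add]; simp)
      rw [good_zero z hz, good_nat m hm k hk s hs] at h
      rw [map_neg, map_neg]
      omega
  have good_sum : ∀ W, InBox M d W → ∀ s : Finset (σ →₀ ℕ), ∀ t,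
      P t = ∑ m ∈ s, monomial m (W.coeff m) → f t = eval y (∑ m ∈ s, monomial m (W.coeff m)) := by
    intro W hW s
    induction s using Finset.induction_on with
    | empty => intro t ht; rw [good_zero t (by simpa using ht)]; simp
    | insert m s hms ih =>
      intro t ht
      rw [Finset.sum_insert hms] at ht ⊢
      obtain ⟨v, hv⟩ := hP _ (hW.restrict s)
      -- When the coefficient vanishes, `m` need not satisfy the degree bounds, but the term drops
      -- out.
      by_cases hm0 : W.coeff m = 0
      · rw [hm0, map_zero, zero_add] at ht ⊢
        exact ih t ht
      · have hm := (hW m).2 hm0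
        obtain ⟨u, hu⟩ := hP _ (inBox_monomial hm (hW m).1)
        rw [← hadd u v t (by rw [hu, hv, ht]), good_int m hm _ (hW m).1 u hu, ih v hv, map_add]
  have := good_sum (P t) ht (P t).support t (P t).as_sum
  rwa [← (P t).as_sum] at this

/-- If every variable occurs in `D`, the system of all identities between polynomials in the box of
`D`, together with `D = 0`, bounds the solutions of `D = 0`. -/
theorem abs_le_bound_of_occurs {ψ : ℕ → ℕ} (hψ : BoundConjecture ψ) {σ : Type} [Fintype σ]
    {D : MvPolynomial σ ℤ} (hD : D ≠ 0) (hocc : ∀ i, 1 ≤ D.degreeOf i)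
    (hfin : {y : σ → ℤ | eval y D = 0}.Finite) {y : σ → ℤ} (hy : eval y D = 0) (i : σ) :
    |y i| ≤ (bound ψ D : ℤ) := by
  classical
  set M := coeffMax D with hMdef
  set d : σ → ℕ := fun i => D.degreeOf i with hd
  -- With `M ≥ 1` and all degrees positive, the box contains `1` and every variable.
  have hM : 1 ≤ M := by
    obtain ⟨m, hm⟩ := ne_zero_iff.1 hD
    have := (inBox_self D m).1
    have h2 := abs_pos.2 hm
    omega
  have hcard : Fintype.card ((∀ i, Fin (d i + 1)) → Fin (2 * M + 1)) = size D := by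
    simp [size, hMdef, hd]
  let e : Fin (size D) ≃ ((∀ i, Fin (d i + 1)) → Fin (2 * M + 1)) :=
    (Fintype.equivFinOfCardEq hcard).symm
  let P : Fin (size D) → MvPolynomial σ ℤ := fun a => tablePoly M d (e a)
  have hP : ∀ W, InBox M d W → ∃ t, P t = W := fun W hW => by
    obtain ⟨t, ht⟩ := exists_tablePoly_eq hW
    exact ⟨e.symm t, by simp [P, ht]⟩
  obtain ⟨δ, hδ⟩ := hP D (inBox_self D)
  have hX : ∀ i, ∃ t, P t = X i := fun i => hP _ <| inBox_monomial
    (fun j => by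
      by_cases hij : i = j
      · subst hij; simpa [hd] using hocc i
      · simp [hij]) (by simpa using hM)
  choose x hx using hX
  -- The extra equation `δ + δ = δ` says that the unknown attached to `D` is `0`.
  let S : Set (Eqn (size D)) := {q | match q with
    | .one a => P a = 1
    | .add a b c => P a + P b = P c ∨ (a = δ ∧ b = δ ∧ c = δ)
    | .mul a b c => P a * P b = P c}
  have heval : ∀ y : σ → ℤ, eval y D = 0 → (fun a => eval y (P a)) ∈ systemSolutions S := by
    rintro y hy (a | ⟨a, b, c⟩ | ⟨a, b, c⟩) hq
    · have hq : P a = 1 := hq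
      simp [Eqn.Holds, hq]
    · have hq : P a + P b = P c ∨ (a = δ ∧ b = δ ∧ c = δ) := hq
      obtain hq | ⟨rfl, rfl, rfl⟩ := hq
      · simp [Eqn.Holds, ← hq]
      · simp [Eqn.Holds, hδ, hy]
    · have hq : P a * P b = P c := hq
      simp [Eqn.Holds, ← hq]
  have hbox : ∀ a, InBox M d (P a) := fun a => inBox_tablePoly _ _ _
  have hsol : ∀ f ∈ systemSolutions S, f = fun a => eval (fun i => f (x i)) (P a) := by
    intro f hf
    funext a
    exact eq_eval_of_respects hM hP (fun a h => hf (.one a) h)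
      (fun a b c h => hf (.add a b c) (Or.inl h)) (fun a b c h => hf (.mul a b c) h) hx (hbox a)
  have hSfin : (systemSolutions S).Finite := by
    refine (hfin.image fun y a => eval y (P a)).subset fun f hf => ⟨fun i => f (x i), ?_, ?_⟩
    · have h := hf (.add δ δ δ) (Or.inr ⟨rfl, rfl, rfl⟩)
      have h2 := congrFun (hsol f hf) δ
      simp only [hδ] at h2
      change eval _ D = 0
      rw [← h2]
      have h : f δ + f δ = f δ := h
      omega
    · exact (hsol f hf).symm
  -- The unknown attached to the polynomial `X i` takes the value `y i`.
  have := hψ _ S hSfin _ (heval y hy) (x i)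
  simpa [hx, bound] using this

theorem eval_update_of_degreeOf_eq_zero {σ : Type} [DecidableEq σ] {D : MvPolynomial σ ℤ} {i : σ}
    (h : D.degreeOf i = 0) (y : σ → ℤ) (v : ℤ) : eval (Function.update y i v) D = eval y D := by
  refine eval₂Hom_congr' rfl (fun j hj _ => ?_) rfl
  have : j ≠ i := by
    rintro rfl
    rw [degreeOf_def, Multiset.count_eq_zero] at h
    exact h (by simpa [vars_def] using hj)
  simp [this]

/-- A variable missing from `D` can be changed freely, so a single zero would give infinitely many.
Finiteness together with the existence of a zero therefore makes every variable occur. -/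
theorem abs_le_bound {ψ : ℕ → ℕ} (hψ : BoundConjecture ψ) {σ : Type} [Fintype σ]
    {D : MvPolynomial σ ℤ} (hfin : {y : σ → ℤ | eval y D = 0}.Finite) {y : σ → ℤ}
    (hy : eval y D = 0) (i : σ) : |y i| ≤ (bound ψ D : ℤ) := by
  classical
  have hocc : ∀ i, 1 ≤ D.degreeOf i := by
    by_contra! hcon
    obtain ⟨j, hj⟩ := hcon
    have hj : D.degreeOf j = 0 := by omega
    refine Set.infinite_of_injective_forall_mem (f := fun v : ℤ => Function.update y j v)
      (Function.update_injective y j) (fun v => ?_) hfin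
    change eval _ D = 0
    rw [eval_update_of_degreeOf_eq_zero hj, hy]
  refine abs_le_bound_of_occurs hψ ?_ hocc hfin hy i
  rintro rfl
  simpa using hocc i

/-! ### Termination of the searches. -/

theorem infinite_iff_forall_exists_lt {α : Type} {p : ℕ} (g : α → ℕ)
    (hg : ∀ v : ℕ, {a | g a ≤ v}.Finite) (A : Set (Fin p → α)) :
    A.Infinite ↔ ∀ B, ∃ y ∈ A, B < Finset.univ.sup fun i => g (y i) := by
  constructor
  · intro hA B
    by_contra! hcon
    refine hA ((Set.Finite.pi fun _ : Fin p => hg B).subset fun y hy i _ => ?_)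
    exact (Finset.le_sup (f := fun i => g (y i)) (Finset.mem_univ i)).trans (hcon y hy)
  · intro h hfin
    obtain ⟨B, hB⟩ := (hfin.image fun y => Finset.univ.sup fun i => g (y i)).bddAbove
    obtain ⟨y, hy, hlt⟩ := h B
    exact absurd (hB ⟨y, hy, rfl⟩) (not_le.2 hlt)

theorem finite_natAbs_le (v : ℕ) : {a : ℤ | a.natAbs ≤ v}.Finite :=
  (Set.finite_Icc (-(v : ℤ)) v).subset fun a ha => by
    have ha : a.natAbs ≤ v := ha
    constructor <;> omega

theorem rfind_map_dom {Q : ℕ → Prop} [DecidablePred Q] (g : ℕ → ℕ) :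
    ((Nat.rfind fun k => Part.some (decide (Q k))).map g).Dom ↔ ∃ k, Q k := by
  refine Nat.rfind_dom.trans ?_
  simp

theorem searchInt_dom (B : ℕ) {p : ℕ} (D : MvPolynomial (Fin p) ℤ) :
    (searchInt B D).Dom ↔ ∃ y ∈ intSolutions D, B < Finset.univ.sup fun i => (y i).natAbs := by
  classical
  refine (rfind_map_dom _).trans ?_
  constructor
  · rintro ⟨k, y, hy, h⟩
    exact ⟨y, hy, by omega⟩
  · rintro ⟨y, hy, h⟩
    obtain ⟨k, hk⟩ := Nat.exists_eq_add_of_lt h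
    exact ⟨k, y, hy, by omega⟩

theorem searchNat_dom (B : ℕ) {p : ℕ} (D : MvPolynomial (Fin p) ℤ) :
    (searchNat B D).Dom ↔ ∃ y ∈ natSolutions D, B < Finset.univ.sup y := by
  classical
  refine (rfind_map_dom _).trans ?_
  constructor
  · rintro ⟨k, y, hy, h⟩
    exact ⟨y, hy, by omega⟩
  · rintro ⟨y, hy, h⟩
    obtain ⟨k, hk⟩ := Nat.exists_eq_add_of_lt h
    exact ⟨k, y, hy, by omega⟩

theorem searchInt_bound_dom {ψ : ℕ → ℕ} (hψ : BoundConjecture ψ) {p : ℕ}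
    (D : MvPolynomial (Fin p) ℤ) :
    (searchInt (bound ψ D) D).Dom ↔ (intSolutions D).Infinite := by
  rw [searchInt_dom]
  constructor
  · rintro ⟨y, hy, hlt⟩ hfin
    obtain ⟨i, -, hi⟩ := Finset.lt_sup_iff.1 hlt
    have := abs_le_bound hψ hfin hy i
    rw [Int.abs_eq_natAbs] at this
    omega
  · exact fun h => (infinite_iff_forall_exists_lt _ finite_natAbs_le _).1 h _

/-! ### Non-negative solutions through four squares. -/

theorem eval_hat {p : ℕ} (D : MvPolynomial (Fin p) ℤ) (z : Fin p × Fin 5 → ℤ) :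
    eval z (hat D) = (eval (fun i => z (i, 0)) D) ^ 2 + ∑ i : Fin p,
      (z (i, 0) - z (i, 1) ^ 2 - z (i, 2) ^ 2 - z (i, 3) ^ 2 - z (i, 4) ^ 2) ^ 2 := by
  simp [hat, eval_rename, Function.comp_def]

theorem eval_hat_eq_zero_iff {p : ℕ} (D : MvPolynomial (Fin p) ℤ) (z : Fin p × Fin 5 → ℤ) :
    eval z (hat D) = 0 ↔ eval (fun i => z (i, 0)) D = 0 ∧
      ∀ i, z (i, 0) = z (i, 1) ^ 2 + z (i, 2) ^ 2 + z (i, 3) ^ 2 + z (i, 4) ^ 2 := by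
  rw [eval_hat, add_eq_zero_iff_of_nonneg (sq_nonneg _) (Finset.sum_nonneg fun i _ => sq_nonneg _),
    Finset.sum_eq_zero_iff_of_nonneg fun i _ => sq_nonneg _]
  simp only [Finset.mem_univ, true_imp_iff, sq_eq_zero_iff]
  refine and_congr_right fun _ => forall_congr' fun i => ?_
  constructor <;> intro h <;> linarith

/-- At a zero of `hat D` each `x_i` is a sum of squares, so the `x_i` form a non-negative solution
of `D = 0` and are at most some `B`. Each of `a_i, b_i, c_i, d_i` has square at most `x_i`, and `|w|
≤ w ^ 2` for integers. -/
theorem finite_hat_solutions {p : ℕ} {D : MvPolynomial (Fin p) ℤ} (h : (natSolutions D).Finite) :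
    {z : Fin p × Fin 5 → ℤ | eval z (hat D) = 0}.Finite := by
  obtain ⟨B, hB⟩ := (h.image fun y => Finset.univ.sup y).bddAbove
  refine (Set.Finite.pi fun _ : Fin p × Fin 5 => Set.finite_Icc (-(B : ℤ)) B).subset ?_
  intro z hz
  obtain ⟨hD, hsq⟩ := (eval_hat_eq_zero_iff D z).1 hz
  have hnn : ∀ i, 0 ≤ z (i, 0) := fun i => by rw [hsq]; positivity
  have hy : (fun i => (z (i, 0)).toNat) ∈ natSolutions D := by
    change eval _ D = 0
    rw [← hD]
    congr 2
    funext i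
    exact Int.toNat_of_nonneg (hnn i)
  have hle : ∀ i, z (i, 0) ≤ B := fun i => by
    have h1 := Finset.le_sup (f := fun i => (z (i, 0)).toNat) (Finset.mem_univ i)
    have h2 := hB ⟨_, hy, rfl⟩
    have h3 : (z (i, 0)).toNat ≤ B := h1.trans h2
    omega
  have key : ∀ w u : ℤ, w ^ 2 ≤ u → -u ≤ w ∧ w ≤ u := fun w u h => by
    constructor
    · nlinarith [Int.le_self_sq (-w)]
    · exact (Int.le_self_sq w).trans h
  rintro ⟨i, j⟩ -
  have hz0 := hle i
  have hs := hsq i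
  have h1 := sq_nonneg (z (i, 1))
  have h2 := sq_nonneg (z (i, 2))
  have h3 := sq_nonneg (z (i, 3))
  have h4 := sq_nonneg (z (i, 4))
  have h0 := hnn i
  fin_cases j
  · exact ⟨by change _ ≤ z (i, 0); omega, hz0⟩
  · exact key _ _ (by change z (i, 1) ^ 2 ≤ _; omega)
  · exact key _ _ (by change z (i, 2) ^ 2 ≤ _; omega)
  · exact key _ _ (by change z (i, 3) ^ 2 ≤ _; omega)
  · exact key _ _ (by change z (i, 4) ^ 2 ≤ _; omega)

theorem searchNat_bound_dom {ψ : ℕ → ℕ} (hψ : BoundConjecture ψ) {p : ℕ}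
    (D : MvPolynomial (Fin p) ℤ) :
    (searchNat (bound ψ (hat D)) D).Dom ↔ (natSolutions D).Infinite := by
  rw [searchNat_dom]
  constructor
  · rintro ⟨y, hy, hlt⟩ hfin
    obtain ⟨i, -, hi⟩ := Finset.lt_sup_iff.1 hlt
    choose a b c d h using fun i => Nat.sum_four_squares (y i)
    have := abs_le_bound hψ (finite_hat_solutions hfin)
      (y := fun q => ![(y q.1 : ℤ), a q.1, b q.1, c q.1, d q.1] q.2)
      ((eval_hat_eq_zero_iff D _).2 ⟨hy, fun i => by simp [← h i]⟩) (i, 0)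
    simp only [Matrix.cons_val_zero, Nat.abs_cast] at this
    omega
  · exact fun h => (infinite_iff_forall_exists_lt id (fun v => Set.finite_Iic v) _).1 h _

end Bounds

section Primitive

open Encodable

/-! ### Primitive recursive arithmetic -/

/-- The encoding of `ℤ` sends `n` to `2 * n` and `-(n + 1)` to `2 * n + 1`; parity and halving
recover sign and size. -/
theorem primrec_intCast : Primrec (fun n : ℕ => (n : ℤ)) :=
  Primrec.encode_iff.1 (Primrec.nat_double.of_eq fun _ => rfl)

theorem primrec_negSucc : Primrec Int.negSucc :=
  Primrec.encode_iff.1 (Primrec.nat_double_succ.of_eq fun _ => rfl)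

theorem primrec_toNat : Primrec Int.toNat := by
  refine (Primrec.ite (c := fun z : ℤ => encode z % 2 = 0)
    (Primrec.eq.comp (Primrec.nat_mod.comp Primrec.encode (Primrec.const 2)) (Primrec.const 0))
    (Primrec.nat_div.comp Primrec.encode (Primrec.const 2)) (Primrec.const 0)).of_eq ?_
  rintro (n | n)
  · change (if (2 * n) % 2 = 0 then (2 * n) / 2 else 0) = n
    rw [if_pos (by omega)]; omega
  · change (if (2 * n + 1) % 2 = 0 then (2 * n + 1) / 2 else 0) = 0
    rw [if_neg (by omega)]

theorem primrec_neg_toNat : Primrec (fun z : ℤ => (-z).toNat) := by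
  refine (Primrec.ite (c := fun z : ℤ => encode z % 2 = 0)
    (Primrec.eq.comp (Primrec.nat_mod.comp Primrec.encode (Primrec.const 2)) (Primrec.const 0))
    (Primrec.const 0)
    (Primrec.succ.comp (Primrec.nat_div.comp Primrec.encode (Primrec.const 2)))).of_eq ?_
  rintro (n | n)
  · change (if (2 * n) % 2 = 0 then 0 else _) = _
    rw [if_pos (by omega), Int.ofNat_eq_natCast]; omega
  · change (if (2 * n + 1) % 2 = 0 then 0 else ((2 * n + 1) / 2).succ) = _
    rw [if_neg (by omega), Int.negSucc_eq]; omega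

/-- Since `z = z.toNat - (-z).toNat`, this difference carries addition and multiplication over from
`ℕ` to `ℤ`. -/
theorem primrec_natCast_sub : Primrec₂ (fun m n : ℕ => (m : ℤ) - n) := by
  refine (Primrec.ite (c := fun q : ℕ × ℕ => q.2 ≤ q.1) (Primrec.nat_le.comp .snd .fst)
    (primrec_intCast.comp (Primrec.nat_sub.comp .fst .snd))
    (primrec_negSucc.comp (Primrec.nat_sub.comp (Primrec.nat_sub.comp .snd .fst)
      (Primrec.const 1)))).of_eq ?_
  rintro ⟨m, n⟩
  dsimp only
  split_ifs
  · omega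
  · rw [Int.negSucc_eq]; omega

theorem primrec_int_add : Primrec₂ (fun a b : ℤ => a + b) :=
  (primrec_natCast_sub.comp
    (Primrec.nat_add.comp (primrec_toNat.comp .fst) (primrec_toNat.comp .snd))
    (Primrec.nat_add.comp (primrec_neg_toNat.comp .fst) (primrec_neg_toNat.comp .snd))).of_eq
    fun q => by push_cast; omega

theorem primrec_int_mul : Primrec₂ (fun a b : ℤ => a * b) :=
  (primrec_natCast_sub.comp
    (Primrec.nat_add.comp
      (Primrec.nat_mul.comp (primrec_toNat.comp .fst) (primrec_toNat.comp .snd))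
      (Primrec.nat_mul.comp (primrec_neg_toNat.comp .fst) (primrec_neg_toNat.comp .snd)))
    (Primrec.nat_add.comp
      (Primrec.nat_mul.comp (primrec_toNat.comp .fst) (primrec_neg_toNat.comp .snd))
      (Primrec.nat_mul.comp (primrec_neg_toNat.comp .fst) (primrec_toNat.comp .snd)))).of_eq
    fun q => by
      obtain ⟨a, b⟩ := q
      have ha : a = a.toNat - (-a).toNat := by omega
      have hb : b = b.toNat - (-b).toNat := by omega
      change _ = a * b
      conv_rhs => rw [ha, hb]
      push_cast
      ring

theorem primrec_natAbs : Primrec Int.natAbs :=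
  (Primrec.nat_add.comp primrec_toNat primrec_neg_toNat).of_eq fun z => by omega

theorem primrec_int_pow : Primrec₂ (fun (a : ℤ) (n : ℕ) => a ^ n) :=
  (Primrec.nat_rec' (h := fun (q : ℤ × ℕ) (r : ℕ × ℤ) => r.2 * q.1) Primrec.snd (Primrec.const 1)
    (primrec_int_mul.comp (Primrec.snd.comp .snd) (Primrec.fst.comp .fst))).of_eq fun q => by
      obtain ⟨a, n⟩ := q
      induction n with
      | zero => simp
      | succ n ih => simpa [pow_succ] using Or.inl ih

theorem primrec_nat_pow : Primrec₂ (fun a n : ℕ => a ^ n) :=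
  Primrec₂.unpaired'.1 Nat.Primrec.pow

theorem computable_doubleExp : Computable doubleExp :=
  (primrec_nat_pow.comp (Primrec.const 2) (primrec_nat_pow.comp (Primrec.const 2)
    (Primrec.nat_sub.comp Primrec.id (Primrec.const 1)))).to_comp

section Lists

variable {α β : Type} [Primcodable α] [Primcodable β] {l : α → List β}

theorem primrec_list_int_sum {g : α → β → ℤ} (hl : Primrec l) (hg : Primrec₂ g) :
    Primrec fun a => ((l a).map (g a)).sum :=
  (Primrec.list_foldr (h := fun _ q => q.1 + q.2) (Primrec.list_map hl hg) (Primrec.const 0)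
    (primrec_int_add.comp (Primrec.fst.comp .snd) (Primrec.snd.comp .snd))).of_eq fun _ => rfl

theorem primrec_list_int_prod {g : α → β → ℤ} (hl : Primrec l) (hg : Primrec₂ g) :
    Primrec fun a => ((l a).map (g a)).prod :=
  (Primrec.list_foldr (h := fun _ q => q.1 * q.2) (Primrec.list_map hl hg) (Primrec.const 1)
    (primrec_int_mul.comp (Primrec.fst.comp .snd) (Primrec.snd.comp .snd))).of_eq fun _ => rfl

theorem primrec_list_nat_prod {g : α → β → ℕ} (hl : Primrec l) (hg : Primrec₂ g) :
    Primrec fun a => ((l a).map (g a)).prod :=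
  (Primrec.list_foldr (h := fun _ q => q.1 * q.2) (Primrec.list_map hl hg) (Primrec.const 1)
    (Primrec.nat_mul.comp (Primrec.fst.comp .snd) (Primrec.snd.comp .snd))).of_eq fun _ => rfl

theorem primrec_list_nat_sup {g : α → β → ℕ} (hl : Primrec l) (hg : Primrec₂ g) :
    Primrec fun a => ((l a).map (g a)).foldr max 0 :=
  Primrec.list_foldr (h := fun _ q => max q.1 q.2) (Primrec.list_map hl hg) (Primrec.const 0)
    (Primrec.nat_max.comp (Primrec.fst.comp .snd) (Primrec.snd.comp .snd))

end Lists

/-! ### The algorithms on codes -/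

/-- The exponents of the first `N` variables. -/
def exponents (N : ℕ) (l : List ℕ) : List ℕ := (List.range N).map fun k => l.getD k 0

/-- The coefficient in `c` of the monomial with exponents `l`. -/
def codeCoeff (c : Code) (l : List ℕ) : ℤ :=
  (c.2.map fun t => if exponents c.1 t.2 = exponents c.1 l then t.1 else 0).sum

/-- The largest absolute value of a coefficient, computed from a code. -/
def codeCoeffMax (c : Code) : ℕ := (c.2.map fun t => (codeCoeff c t.2).natAbs).foldr max 0

/-- The degree in the `k`-th variable, computed from a code. -/
def codeDegree (c : Code) (k : ℕ) : ℕ :=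
  (c.2.map fun t => if codeCoeff c t.2 = 0 then 0 else t.2.getD k 0).foldr max 0

/-- The size of a polynomial, computed from a code. -/
def codeSize (c : Code) : ℕ :=
  (2 * codeCoeffMax c + 1) ^ ((List.range c.1).map fun k => codeDegree c k + 1).prod

/-- The value of a polynomial, computed from a code. -/
def codeEval (c : Code) (y : List ℤ) : ℤ :=
  (c.2.map fun t => t.1 * ((List.range c.1).map fun k => y.getD k 0 ^ t.2.getD k 0).prod).sum

/-- The first `p` digits of `q` in base `b`, lowered by `s`. -/
def digitPoint (p b s q : ℕ) : List ℤ :=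
  (List.range p).map fun k => ((q / b ^ k % b : ℕ) : ℤ) - s

/-- Some zero of `c` with coordinates in `[-s, b - s)` has largest absolute value `α`. -/
def HasZero (c : Code) (b s α : ℕ) : Prop :=
  ∃ q < b ^ c.1, codeEval c (digitPoint c.1 b s q) = 0 ∧
    ((digitPoint c.1 b s q).map Int.natAbs).foldr max 0 = α

/-- The product of two lists of terms in `N` variables. -/
def mulTerms (N : ℕ) (L₁ L₂ : List (ℤ × List ℕ)) : List (ℤ × List ℕ) :=
  L₁.flatMap fun a => L₂.map fun b =>
    (a.1 * b.1, (List.range N).map fun k => a.2.getD k 0 + b.2.getD k 0)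

/-- The exponents of the `v`-th power of the `k`-th of `N` variables. -/
def powerExponents (N k v : ℕ) : List ℕ := (List.range N).map fun j => if j = k then v else 0

/-- The terms of `x_i - a_i ^ 2 - b_i ^ 2 - c_i ^ 2 - d_i ^ 2`. -/
def squareTerms (N i : ℕ) : List (ℤ × List ℕ) :=
  [(1, powerExponents N (5 * i) 1), (-1, powerExponents N (5 * i + 1) 2),
    (-1, powerExponents N (5 * i + 2) 2), (-1, powerExponents N (5 * i + 3) 2),
    (-1, powerExponents N (5 * i + 4) 2)]

/-- The terms of `c` with the `i`-th variable renamed to the `5 i`-th. -/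
def spreadTerms (c : Code) : List (ℤ × List ℕ) :=
  c.2.map fun t =>
    (t.1, (List.range (c.1 * 5)).map fun k => if k % 5 = 0 then t.2.getD (k / 5) 0 else 0)

/-- A code of `hat c.poly`, with the variables numbered by `finProdFinEquiv`. -/
def hatCode (c : Code) : Code :=
  (c.1 * 5, mulTerms (c.1 * 5) (spreadTerms c) (spreadTerms c) ++
    (List.range c.1).flatMap fun i =>
      mulTerms (c.1 * 5) (squareTerms (c.1 * 5) i) (squareTerms (c.1 * 5) i))

theorem primrec_exponents : Primrec₂ exponents :=
  Primrec.list_map (Primrec.list_range.comp .fst)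
    ((Primrec.list_getD 0).comp (Primrec.snd.comp .fst) .snd)

theorem primrec_codeCoeff : Primrec₂ codeCoeff :=
  primrec_list_int_sum (Primrec.snd.comp .fst) <| Primrec.ite
    (Primrec.eq.comp
      (primrec_exponents.comp (Primrec.fst.comp (Primrec.fst.comp .fst)) (Primrec.snd.comp .snd))
      (primrec_exponents.comp (Primrec.fst.comp (Primrec.fst.comp .fst)) (Primrec.snd.comp .fst)))
    (Primrec.fst.comp .snd) (Primrec.const 0)

theorem primrec_codeCoeffMax : Primrec codeCoeffMax :=
  primrec_list_nat_sup .snd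
    (primrec_natAbs.comp (primrec_codeCoeff.comp .fst (Primrec.snd.comp .snd)))

theorem primrec_codeDegree : Primrec₂ codeDegree :=
  primrec_list_nat_sup (Primrec.snd.comp .fst) <| Primrec.ite
    (Primrec.eq.comp (primrec_codeCoeff.comp (Primrec.fst.comp .fst) (Primrec.snd.comp .snd))
      (Primrec.const 0))
    (Primrec.const 0)
    ((Primrec.list_getD 0).comp (Primrec.snd.comp .snd) (Primrec.snd.comp .fst))

theorem primrec_codeSize : Primrec codeSize :=
  primrec_nat_pow.comp (Primrec.succ.comp (Primrec.nat_double.comp primrec_codeCoeffMax))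
    (primrec_list_nat_prod (Primrec.list_range.comp .fst) (Primrec.succ.comp primrec_codeDegree))

theorem primrec_codeEval : Primrec₂ codeEval :=
  primrec_list_int_sum (Primrec.snd.comp .fst) <| primrec_int_mul.comp (Primrec.fst.comp .snd) <|
    primrec_list_int_prod (Primrec.list_range.comp (Primrec.fst.comp (Primrec.fst.comp .fst))) <|
      primrec_int_pow.comp
        ((Primrec.list_getD 0).comp (Primrec.snd.comp (Primrec.fst.comp .fst)) .snd)
        ((Primrec.list_getD 0).comp (Primrec.snd.comp (Primrec.snd.comp .fst)) .snd)

theorem primrec_digitPoint :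
    Primrec fun r : ℕ × ℕ × ℕ × ℕ => digitPoint r.1 r.2.1 r.2.2.1 r.2.2.2 :=
  have hb : Primrec fun r : (ℕ × ℕ × ℕ × ℕ) × ℕ => r.1.2.1 :=
    Primrec.fst.comp (Primrec.snd.comp .fst)
  have hs : Primrec fun r : (ℕ × ℕ × ℕ × ℕ) × ℕ => r.1.2.2.1 :=
    Primrec.fst.comp (Primrec.snd.comp (Primrec.snd.comp .fst))
  have hq : Primrec fun r : (ℕ × ℕ × ℕ × ℕ) × ℕ => r.1.2.2.2 :=
    Primrec.snd.comp (Primrec.snd.comp (Primrec.snd.comp .fst))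
  Primrec.list_map (Primrec.list_range.comp .fst) <| primrec_natCast_sub.comp
    (Primrec.nat_mod.comp (Primrec.nat_div.comp hq (primrec_nat_pow.comp hb .snd)) hb) hs

/-- A candidate point is a single number `q < b ^ p` read through its digits, so the existential is
a bounded search. -/
theorem primrecPred_hasZero :
    PrimrecPred fun r : Code × ℕ × ℕ × ℕ => HasZero r.1 r.2.1 r.2.2.1 r.2.2.2 := by
  have hpt : Primrec fun u : ℕ × Code × ℕ × ℕ × ℕ =>
      digitPoint u.2.1.1 u.2.2.1 u.2.2.2.1 u.1 :=
    primrec_digitPoint.comp (Primrec.pair (Primrec.fst.comp (Primrec.fst.comp .snd))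
      (Primrec.pair (Primrec.fst.comp (Primrec.snd.comp .snd))
        (Primrec.pair (Primrec.fst.comp (Primrec.snd.comp (Primrec.snd.comp .snd))) .fst)))
  have hrel : PrimrecRel fun (q : ℕ) (r : Code × ℕ × ℕ × ℕ) =>
      codeEval r.1 (digitPoint r.1.1 r.2.1 r.2.2.1 q) = 0 ∧
        ((digitPoint r.1.1 r.2.1 r.2.2.1 q).map Int.natAbs).foldr max 0 = r.2.2.2 :=
    (Primrec.eq.comp (primrec_codeEval.comp (Primrec.fst.comp .snd) hpt) (Primrec.const 0)).and
      (Primrec.eq.comp (primrec_list_nat_sup hpt (primrec_natAbs.comp .snd))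
        (Primrec.snd.comp (Primrec.snd.comp (Primrec.snd.comp .snd))))
  exact (hrel.exists_mem_list.comp
    (f := fun r : Code × ℕ × ℕ × ℕ => List.range (r.2.1 ^ r.1.1)) (g := fun r => r)
    (Primrec.list_range.comp
      (primrec_nat_pow.comp (Primrec.fst.comp .snd) (Primrec.fst.comp .fst))) Primrec.id).of_eq
    fun r => by simp [HasZero]

theorem primrec_mulTerms {α : Type} [Primcodable α] {N : α → ℕ} {f g : α → List (ℤ × List ℕ)}
    (hN : Primrec N) (hf : Primrec f) (hg : Primrec g) :
    Primrec fun a => mulTerms (N a) (f a) (g a) :=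
  Primrec.list_flatMap hf <| Primrec.list_map (hg.comp .fst) <| Primrec.pair
    (primrec_int_mul.comp (Primrec.fst.comp (Primrec.snd.comp .fst)) (Primrec.fst.comp .snd))
    (Primrec.list_map (Primrec.list_range.comp (hN.comp (Primrec.fst.comp .fst)))
      (Primrec.nat_add.comp
        ((Primrec.list_getD 0).comp
          (Primrec.snd.comp (Primrec.snd.comp (Primrec.fst.comp .fst))) .snd)
        ((Primrec.list_getD 0).comp (Primrec.snd.comp (Primrec.snd.comp .fst)) .snd)))

theorem primrec_powerExponents {α : Type} [Primcodable α] {N k : α → ℕ} (hN : Primrec N)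
    (hk : Primrec k) (v : ℕ) : Primrec fun a => powerExponents (N a) (k a) v :=
  Primrec.list_map (Primrec.list_range.comp hN) <|
    Primrec.ite (Primrec.eq.comp .snd (hk.comp .fst)) (Primrec.const v) (Primrec.const 0)

theorem primrec_squareTerms : Primrec₂ squareTerms := by
  have hk : ∀ j, Primrec fun a : ℕ × ℕ => 5 * a.2 + j := fun j =>
    Primrec.nat_add.comp (Primrec.nat_mul.comp (Primrec.const 5) .snd) (Primrec.const j)
  have ht : ∀ (c : ℤ) (j v : ℕ),
      Primrec fun a : ℕ × ℕ => (c, powerExponents a.1 (5 * a.2 + j) v) := fun c j v =>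
    Primrec.pair (Primrec.const c) (primrec_powerExponents .fst (hk j) v)
  exact Primrec.list_cons.comp (ht 1 0 1) <| Primrec.list_cons.comp (ht (-1) 1 2) <|
    Primrec.list_cons.comp (ht (-1) 2 2) <| Primrec.list_cons.comp (ht (-1) 3 2) <|
    Primrec.list_cons.comp (ht (-1) 4 2) (Primrec.const [])

theorem primrec_spreadTerms : Primrec spreadTerms :=
  Primrec.list_map .snd <| Primrec.pair (Primrec.fst.comp .snd) <|
    Primrec.list_map
      (Primrec.list_range.comp
        (Primrec.nat_mul.comp (Primrec.fst.comp .fst) (Primrec.const 5))) <|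
      Primrec.ite
        (Primrec.eq.comp (Primrec.nat_mod.comp .snd (Primrec.const 5)) (Primrec.const 0))
        ((Primrec.list_getD 0).comp (Primrec.snd.comp (Primrec.snd.comp .fst))
          (Primrec.nat_div.comp .snd (Primrec.const 5)))
        (Primrec.const 0)

theorem primrec_hatCode : Primrec hatCode := by
  have hN : Primrec fun c : Code => c.1 * 5 := Primrec.nat_mul.comp .fst (Primrec.const 5)
  have hs : Primrec fun r : Code × ℕ => squareTerms (r.1.1 * 5) r.2 :=
    primrec_squareTerms.comp (hN.comp .fst) .snd
  exact Primrec.pair hN <| Primrec.list_append.comp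
    (primrec_mulTerms hN primrec_spreadTerms primrec_spreadTerms)
    (Primrec.list_flatMap (Primrec.list_range.comp .fst) (primrec_mulTerms (hN.comp .fst) hs hs))

end Primitive

section Correctness

open MvPolynomial

/-! ### Correctness of the algorithms -/

theorem foldr_max_le_iff (l : List ℕ) (B : ℕ) : l.foldr max 0 ≤ B ↔ ∀ a ∈ l, a ≤ B := by
  induction l with
  | nil => simp
  | cons a l ih => simp [ih]

/-- The list `l` of exponents as the exponent vector of a monomial in `N` variables. -/
noncomputable def expVec (N : ℕ) (l : List ℕ) : Fin N →₀ ℕ :=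
  Finsupp.equivFunOnFinite.symm fun i : Fin N => l.getD i 0

theorem expVec_apply (N : ℕ) (l : List ℕ) (i : Fin N) : expVec N l i = l.getD i 0 := rfl

theorem Code.poly_eq (c : Code) :
    c.poly = (c.2.map fun t => monomial (expVec c.1 t.2) t.1).sum := rfl

/-- Lists describing one monomial may differ by padding or superfluous entries; cutting them to `N`
entries makes equality of monomials decidable on codes. -/
theorem exponents_eq_iff {N : ℕ} {l l' : List ℕ} :
    exponents N l = exponents N l' ↔ expVec N l = expVec N l' := by
  simp only [exponents, List.map_inj_left, List.mem_range, DFunLike.ext_iff, expVec_apply]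
  exact ⟨fun h i => h i i.2, fun h k hk => h ⟨k, hk⟩⟩

theorem coeff_poly_eq_sum (c : Code) (m : Fin c.1 →₀ ℕ) :
    c.poly.coeff m = (c.2.map fun t => if expVec c.1 t.2 = m then t.1 else 0).sum := by
  rw [Code.poly_eq, ← lcoeff_apply (R := ℤ), map_list_sum, List.map_map]
  congr 1
  refine List.map_congr_left fun t _ => ?_
  simp [coeff_monomial]

theorem coeff_poly (c : Code) (l : List ℕ) : c.poly.coeff (expVec c.1 l) = codeCoeff c l := by
  simp [coeff_poly_eq_sum, codeCoeff, exponents_eq_iff]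

theorem exists_of_mem_support {c : Code} {m : Fin c.1 →₀ ℕ} (h : m ∈ c.poly.support) :
    ∃ t ∈ c.2, expVec c.1 t.2 = m := by
  by_contra! hcon
  refine mem_support_iff.1 h ?_
  rw [coeff_poly_eq_sum]
  refine List.sum_eq_zero fun a ha => ?_
  obtain ⟨t, ht, rfl⟩ := List.mem_map.1 ha
  exact if_neg (hcon t ht)

theorem coeffMax_poly (c : Code) : coeffMax c.poly = codeCoeffMax c := by
  refine le_antisymm (Finset.sup_le fun m hm => ?_) ((foldr_max_le_iff _ _).2 fun a ha => ?_)
  · obtain ⟨t, ht, rfl⟩ := exists_of_mem_support hm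
    rw [coeff_poly]
    exact (foldr_max_le_iff _ _).1 le_rfl _ (List.mem_map.2 ⟨t, ht, rfl⟩)
  · obtain ⟨t, -, rfl⟩ := List.mem_map.1 ha
    have := (inBox_self c.poly (expVec c.1 t.2)).1
    rw [coeff_poly, Int.abs_eq_natAbs] at this
    omega

/-- Listed terms can cancel. Those whose total coefficient is `0` are ignored by `codeDegree`, and
every monomial that survives is listed. -/
theorem degreeOf_poly (c : Code) (i : Fin c.1) : c.poly.degreeOf i = codeDegree c i := by
  refine le_antisymm (degreeOf_le_iff.2 fun m hm => ?_) ((foldr_max_le_iff _ _).2 fun a ha => ?_)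
  · obtain ⟨t, ht, rfl⟩ := exists_of_mem_support hm
    refine (foldr_max_le_iff _ _).1 le_rfl _ (List.mem_map.2 ⟨t, ht, ?_⟩)
    rw [mem_support_iff, coeff_poly] at hm
    simp only [if_neg hm]
    rfl
  · obtain ⟨t, -, rfl⟩ := List.mem_map.1 ha
    split_ifs with h
    · exact Nat.zero_le _
    · rw [← coeff_poly] at h
      exact (inBox_self c.poly _).2 h i

theorem size_poly (c : Code) : size c.poly = codeSize c := by
  simp only [size, codeSize, coeffMax_poly, degreeOf_poly]
  rw [← List.prod_ofFn]
  congr 2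
  apply List.ext_getElem <;> simp

theorem eval_poly (c : Code) (y : Fin c.1 → ℤ) : eval y c.poly = codeEval c (List.ofFn y) := by
  rw [Code.poly_eq, codeEval, map_list_sum, List.map_map]
  congr 1
  refine List.map_congr_left fun t _ => ?_
  simp only [Function.comp, eval_monomial]
  rw [Finsupp.prod_fintype _ _ (by simp), ← List.prod_ofFn]
  congr 2
  apply List.ext_getElem
  · simp
  · intro k h1 h2
    have hk : k < c.1 := by simpa using h1
    simp [expVec_apply, hk]

theorem digitPoint_eq_ofFn {p b : ℕ} (s : ℕ) (f : Fin p → Fin b) :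
    digitPoint p b s (finFunctionFinEquiv f) = List.ofFn fun i => ((f i : ℕ) : ℤ) - s := by
  apply List.ext_getElem
  · simp [digitPoint]
  · intro k h1 h2
    have hk : k < p := by simpa using h2
    -- `finFunctionFinEquiv.symm` reads off base-`b` digits.
    have := congrFun (finFunctionFinEquiv.symm_apply_apply f) ⟨k, hk⟩
    rw [Fin.ext_iff, finFunctionFinEquiv_symm_apply_val] at this
    simp [digitPoint, ← this]

theorem foldr_max_natAbs_ofFn {p : ℕ} (y : Fin p → ℤ) :
    ((List.ofFn y).map Int.natAbs).foldr max 0 = Finset.univ.sup fun i => (y i).natAbs := by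
  refine eq_of_forall_ge_iff fun B => ?_
  simp [foldr_max_le_iff, Finset.sup_le_iff, List.mem_ofFn]

theorem hasZero_iff (c : Code) (b s α : ℕ) :
    HasZero c b s α ↔ ∃ f : Fin c.1 → Fin b,
      (fun i => ((f i : ℕ) : ℤ) - s) ∈ intSolutions c.poly ∧
        (Finset.univ.sup fun i => (((f i : ℕ) : ℤ) - s).natAbs) = α := by
  have key : ∀ f : Fin c.1 → Fin b,
      (codeEval c (digitPoint c.1 b s (finFunctionFinEquiv f)) = 0 ∧
        ((digitPoint c.1 b s (finFunctionFinEquiv f)).map Int.natAbs).foldr max 0 = α) ↔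
      ((fun i => ((f i : ℕ) : ℤ) - s) ∈ intSolutions c.poly ∧
        (Finset.univ.sup fun i => (((f i : ℕ) : ℤ) - s).natAbs) = α) := fun f => by
    rw [digitPoint_eq_ofFn, foldr_max_natAbs_ofFn, ← eval_poly]
    rfl
  constructor
  · rintro ⟨q, hq, h⟩
    refine ⟨finFunctionFinEquiv.symm ⟨q, hq⟩, (key _).1 ?_⟩
    simpa using h
  · rintro ⟨f, h⟩
    exact ⟨_, (finFunctionFinEquiv f).is_lt, (key f).2 h⟩

/-- Base `2 * α + 1` with shift `α` runs through exactly the cube `[-α, α] ^ p`, which contains all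
points of maximum norm `α`. -/
theorem hasZero_int_iff (c : Code) (α : ℕ) :
    HasZero c (2 * α + 1) α α ↔
      ∃ y ∈ intSolutions c.poly, (Finset.univ.sup fun i => (y i).natAbs) = α := by
  rw [hasZero_iff]
  constructor
  · rintro ⟨f, h⟩
    exact ⟨_, h⟩
  · rintro ⟨y, hy, h⟩
    have hle : ∀ i, (y i).natAbs ≤ α := fun i =>
      h ▸ Finset.le_sup (f := fun i => (y i).natAbs) (Finset.mem_univ i)
    have heq : ∀ i, (((y i + α).toNat : ℕ) : ℤ) - α = y i := fun i => by have := hle i; omega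
    refine ⟨fun i => ⟨(y i + α).toNat, by have := hle i; omega⟩, ?_⟩
    simpa only [heq] using ⟨hy, h⟩

theorem hasZero_nat_iff (c : Code) (α : ℕ) :
    HasZero c (α + 1) 0 α ↔ ∃ y ∈ natSolutions c.poly, Finset.univ.sup y = α := by
  rw [hasZero_iff]
  simp only [Nat.cast_zero, sub_zero, Int.natAbs_natCast]
  constructor
  · rintro ⟨f, h⟩
    exact ⟨_, h⟩
  · rintro ⟨y, hy, h⟩
    have hle : ∀ i, y i ≤ α := fun i => h ▸ Finset.le_sup (Finset.mem_univ i)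
    exact ⟨fun i => ⟨y i, Nat.lt_succ_of_le (hle i)⟩, hy, h⟩

/-! ### The code of `hat` -/

theorem poly_append (N : ℕ) (L₁ L₂ : List (ℤ × List ℕ)) :
    Code.poly (N, L₁ ++ L₂) = Code.poly (N, L₁) + Code.poly (N, L₂) := by
  simp [Code.poly_eq]

theorem poly_flatMap (N p : ℕ) (g : ℕ → List (ℤ × List ℕ)) :
    Code.poly (N, (List.range p).flatMap g) = ∑ i : Fin p, Code.poly (N, g i) := by
  induction p with
  | zero => simp [Code.poly_eq]
  | succ p ih =>
    rw [List.range_succ, List.flatMap_append, poly_append, ih, Fin.sum_univ_castSucc,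
      List.flatMap_singleton]
    simp

theorem poly_cons (N : ℕ) (t : ℤ × List ℕ) (L : List (ℤ × List ℕ)) :
    Code.poly (N, t :: L) = monomial (expVec N t.2) t.1 + Code.poly (N, L) := by
  simp [Code.poly_eq]

theorem poly_nil (N : ℕ) : Code.poly (N, []) = 0 := by
  simp [Code.poly_eq]

theorem getD_map_range (N : ℕ) (g : ℕ → ℕ) (i : Fin N) :
    ((List.range N).map g).getD i 0 = g i := by
  simp [List.getD]

theorem poly_mulTerms (N : ℕ) (L₁ L₂ : List (ℤ × List ℕ)) :
    Code.poly (N, mulTerms N L₁ L₂) = Code.poly (N, L₁) * Code.poly (N, L₂) := by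
  induction L₁ with
  | nil => rw [mulTerms, List.flatMap_nil, poly_nil, zero_mul]
  | cons a L₁ ih =>
    rw [poly_cons, add_mul, ← ih, mulTerms, List.flatMap_cons, poly_append]
    congr 1
    rw [Code.poly_eq (N, L₂), ← List.sum_map_mul_left, Code.poly_eq]
    dsimp only
    rw [List.map_map]
    congr 1
    refine List.map_congr_left fun b _ => ?_
    simp only [Function.comp, monomial_mul]
    congr 2
    refine DFunLike.ext _ _ fun i => ?_
    rw [expVec_apply, getD_map_range]
    rfl

theorem expVec_powerExponents {N : ℕ} (k : Fin N) (v : ℕ) :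
    expVec N (powerExponents N k v) = Finsupp.single k v := by
  ext i
  rw [expVec_apply, powerExponents, getD_map_range, Finsupp.single_apply]
  simp [Fin.ext_iff, eq_comm]

theorem poly_squareTerms {p : ℕ} (i : Fin p) :
    Code.poly (p * 5, squareTerms (p * 5) i) =
      rename finProdFinEquiv (X (i, 0) - X (i, 1) ^ 2 - X (i, 2) ^ 2 - X (i, 3) ^ 2
        - X (i, 4) ^ 2 : MvPolynomial (Fin p × Fin 5) ℤ) := by
  have h : ∀ (j : Fin 5) (c : ℤ) (v : ℕ),
      monomial (expVec (p * 5) (powerExponents (p * 5) (5 * i + j) v)) c =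
        C c * X (finProdFinEquiv (i, j)) ^ v := fun j c v => by
    -- `finProdFinEquiv` numbers the pair `(i, j)` as `j + 5 * i`.
    have hk : 5 * (i : ℕ) + j = (finProdFinEquiv (i, j) : Fin (p * 5)) := by
      simp [finProdFinEquiv, add_comm]
    rw [hk, expVec_powerExponents, C_mul_X_pow_eq_monomial]
  have h0 := h 0
  have h1 := h 1
  have h2 := h 2
  have h3 := h 3
  have h4 := h 4
  norm_num at h0 h1 h2 h3 h4
  simp only [squareTerms, poly_cons, poly_nil, h0, h1, h2, h3, h4, map_sub, map_pow, rename_X]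
  simp
  ring

theorem poly_spreadTerms (c : Code) :
    Code.poly (c.1 * 5, spreadTerms c) =
      rename finProdFinEquiv (rename (fun i => (i, (0 : Fin 5))) c.poly) := by
  rw [rename_rename, Code.poly_eq c, map_list_sum, Code.poly_eq, spreadTerms, List.map_map,
    List.map_map]
  congr 1
  refine List.map_congr_left fun t _ => ?_
  have hinj : Function.Injective
      (finProdFinEquiv ∘ fun i : Fin c.1 => (i, (0 : Fin 5))) :=
    finProdFinEquiv.injective.comp fun a b h => congrArg Prod.fst h
  simp only [Function.comp_apply, rename_monomial]
  congr 2
  refine DFunLike.ext _ _ fun k => ?_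
  obtain ⟨⟨i, j⟩, rfl⟩ := finProdFinEquiv.surjective k
  rw [expVec_apply, getD_map_range]
  by_cases hj : j = 0
  · subst hj
    have := Finsupp.mapDomain_apply hinj (expVec c.1 t.2) i
    rw [Function.comp_apply] at this
    rw [this, expVec_apply]
    simp [finProdFinEquiv]
  -- Variables with `j ≠ 0` are the auxiliary ones: their index is not divisible by `5` and they do
  -- not occur in the renamed `D`.
  · rw [Finsupp.mapDomain_of_notMem_range]
    · have : ¬ ((finProdFinEquiv (i, j) : ℕ) % 5 = 0) := by
        intro h
        apply hj
        ext
        have h2 := j.is_lt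
        simp [finProdFinEquiv] at h
        simp
        omega
      rw [if_neg this]
    · rintro ⟨i', h⟩
      have := finProdFinEquiv.injective h
      exact hj (congrArg Prod.snd this).symm

theorem poly_hatCode (c : Code) : (hatCode c).poly = rename finProdFinEquiv (hat c.poly) := by
  change Code.poly (c.1 * 5, _) = _
  rw [poly_append, poly_flatMap, hat, map_add, map_sum, poly_mulTerms, poly_spreadTerms, map_pow,
    sq]
  congr 1
  refine Finset.sum_congr rfl fun i _ => ?_
  rw [poly_mulTerms, poly_squareTerms, map_pow, sq (rename _ _)]

/-- Coefficients and degrees are only permuted, so numbering the variables of `hat D` for its code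
leaves the bound unchanged. -/
theorem size_rename {σ τ : Type} [Fintype σ] [Fintype τ] (e : σ ≃ τ) (D : MvPolynomial σ ℤ) :
    size (rename e D) = size D := by
  classical
  have hM : coeffMax (rename e D) = coeffMax D := by
    rw [coeffMax, support_rename_of_injective e.injective, Finset.sup_image]
    refine Finset.sup_congr rfl fun m _ => ?_
    simp [coeff_rename_mapDomain _ e.injective]
  have hd : ∏ i, ((rename e D).degreeOf i + 1) = ∏ i, (D.degreeOf i + 1) := by
    rw [← e.prod_comp]
    simp [degreeOf_rename_of_injective e.injective]
  rw [size, size, hM, hd]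

theorem size_hat_poly (c : Code) : size (hat c.poly) = codeSize (hatCode c) := by
  rw [← size_poly, poly_hatCode]
  exact (size_rename _ _).symm

/-! ### Partial recursiveness -/

/-- The test at each stage is primitive recursive, whereas the starting point is only computable
because it involves `ψ`. Any decidability instance is allowed, so the classical one in the
definition of the searches does no harm. -/
theorem partrec_search {B : Code → ℕ} (hB : Computable B) {Q : Code → ℕ → Prop}
    [∀ c α, Decidable (Q c α)] (hQ : PrimrecRel Q) :
    Partrec fun c => (Nat.rfind fun k => Part.some (decide (Q c (B c + 1 + k)))).map
      fun k => B c + 1 + k := by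
  have hα : Computable fun r : Code × ℕ => B r.1 + 1 + r.2 :=
    (Primrec.nat_add.to_comp).comp (Computable.succ.comp (hB.comp .fst)) .snd
  have hdec : Computable₂ fun (c : Code) (k : ℕ) => decide (Q c (B c + 1 + k)) :=
    (PrimrecRel.decide hQ).to_comp.comp Computable.fst hα
  exact (Partrec.rfind hdec.partrec₂).map hα

theorem primrecRel_int_zero : PrimrecRel fun (c : Code) (α : ℕ) =>
    ∃ y ∈ intSolutions c.poly, (Finset.univ.sup fun i => (y i).natAbs) = α :=
  (primrecPred_hasZero.comp (f := fun r : Code × ℕ => (r.1, 2 * r.2 + 1, r.2, r.2))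
    (.pair .fst (.pair (Primrec.nat_double_succ.comp .snd) (.pair .snd .snd)))).of_eq
    fun r => hasZero_int_iff r.1 r.2

theorem primrecRel_nat_zero : PrimrecRel fun (c : Code) (α : ℕ) =>
    ∃ y ∈ natSolutions c.poly, Finset.univ.sup y = α :=
  (primrecPred_hasZero.comp (f := fun r : Code × ℕ => (r.1, r.2 + 1, 0, r.2))
    (.pair .fst (.pair (Primrec.succ.comp .snd) (.pair (.const 0) .snd)))).of_eq
    fun r => hasZero_nat_iff r.1 r.2

theorem partrec_semiInt {ψ : ℕ → ℕ} (hψ : Computable ψ) : Partrec (semiInt ψ) := by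
  classical
  have hB : Computable fun c : Code => bound ψ c.poly :=
    (hψ.comp primrec_codeSize.to_comp).of_eq fun c => by rw [bound, size_poly]
  exact partrec_search hB primrecRel_int_zero

theorem partrec_semiNat {ψ : ℕ → ℕ} (hψ : Computable ψ) : Partrec (semiNat ψ) := by
  classical
  have hB : Computable fun c : Code => bound ψ (hat c.poly) :=
    (hψ.comp (primrec_codeSize.comp primrec_hatCode).to_comp).of_eq
      fun c => by rw [bound, size_hat_poly]
  exact partrec_search hB primrecRel_nat_zero

theorem semiInt_dom_iff {ψ : ℕ → ℕ} (hψ : BoundConjecture ψ) (c : Code) :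
    (semiInt ψ c).Dom ↔ c.equation ∈ infiniteInt :=
  searchInt_bound_dom hψ c.poly

theorem semiNat_dom_iff {ψ : ℕ → ℕ} (hψ : BoundConjecture ψ) (c : Code) :
    (semiNat ψ c).Dom ↔ c.equation ∈ infiniteNat :=
  searchNat_bound_dom hψ c.poly

theorem isRE_infiniteInt {ψ : ℕ → ℕ} (hc : Computable ψ) (hψ : BoundConjecture ψ) :
    IsRE infiniteInt :=
  (partrec_semiInt hc).dom_re.of_eq (semiInt_dom_iff hψ)

theorem isRE_infiniteNat {ψ : ℕ → ℕ} (hc : Computable ψ) (hψ : BoundConjecture ψ) :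
    IsRE infiniteNat :=
  (partrec_semiNat hc).dom_re.of_eq (semiNat_dom_iff hψ)

end Correctness

end Dio

theorem theorem5 :
    -- the conjecture implies recursive enumerability
    (Dio.Conjecture1 → Dio.IsRE Dio.infiniteInt ∧ Dio.IsRE Dio.infiniteNat) ∧
    -- the semi-algorithms, for `2 ^ (2 ^ (n - 1))` and for any other computable bound `ψ`
    Computable Dio.doubleExp ∧
    ∀ ψ : ℕ → ℕ, Computable ψ →
      Partrec (Dio.semiInt ψ) ∧ Partrec (Dio.semiNat ψ) ∧
      (Dio.BoundConjecture ψ →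
        (∀ c : Dio.Code, (Dio.semiInt ψ c).Dom ↔ c.equation ∈ Dio.infiniteInt) ∧
        (∀ c : Dio.Code, (Dio.semiNat ψ c).Dom ↔ c.equation ∈ Dio.infiniteNat) ∧
        Dio.IsRE Dio.infiniteInt ∧ Dio.IsRE Dio.infiniteNat) := by
  refine ⟨fun h => ⟨Dio.isRE_infiniteInt Dio.computable_doubleExp h,
    Dio.isRE_infiniteNat Dio.computable_doubleExp h⟩, Dio.computable_doubleExp, fun ψ hc =>
    ⟨Dio.partrec_semiInt hc, Dio.partrec_semiNat hc, fun h =>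
      ⟨Dio.semiInt_dom_iff h, Dio.semiNat_dom_iff h, Dio.isRE_infiniteInt hc h,
        Dio.isRE_infiniteNat hc h⟩⟩⟩
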